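/- Let $d\in\{2,3\}$, let $n\ge 1$ be an integer, let $k>0$, let $m\in(d+2-4n,d]$, let $s$ be a positive integer with $s>\frac d4+2n-1$, and let $B_1$ be the open unit ball of $\mathbb R^d$. Let $\sigma\ge 0$ be a function on $\mathbb R^d$ with $\sqrt\sigma\in W_0^{s,4}(B_1)$ (extended by zero outside $B_1$). Let $f$ be a real-valued, centered, generalized Gaussian random field on $\mathbb R^d$ whose realizations are almost surely distributions supported in $\overline{B_1}$. Suppose that its covariance operator $\mathcal Q_f$, $\langle \mathcal Q_f\phi,\psi\rangle=\mathbb E[\langle f,\phi\rangle\langle f,\psi\rangle]$ for $\phi,\psi\in C_c^\infty(\mathbb R^d;\mathbb R)$, is $$\mathcal Q_f\phi(x)=\frac1{(2\pi)^d}\int_{\mathbb R^d}e^{\mathrm i x\cdot\xi}c(x,\xi)\widehat\phi(\xi)\,d\xi,\qquad \widehat\phi(\xi)=\int_{\mathbb R^d}\phi(y)e^{-\mathrm i y\cdot\xi}\,dy,$$ with a symbol $c(x,\xi)=\sigma(x)|\xi|^{-m}+r(x,\xi)$. Here $r\in C^\infty(\mathbb R^d\times\mathbb R^d)$ satisfies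 $|\partial_x^\alpha\partial_\xi^\beta r(x,\xi)|\le C_{\alpha,\beta}(1+|\xi|^2)^{\frac{-m-1-|\beta|}2}$ for all multi-indices $\alpha,\beta$, and $r(\cdot,\xi)\in C_c^\infty(B_1)$ for every $\xi$; as usual for a principal symbol, $|\xi|^{-m}$ may be replaced, for $\xi$ in a bounded set, by any values that make it locally integrable on $\mathbb R^d$ (for $m<d$ no replacement is necessary). Let $$u^\infty(\hat x,k)=-\frac{\beta_d}{n}\,k^{\frac{d+1-4n}2}\int_{\mathbb R^d}e^{\mathrm i k\hat x\cdot y}f(y)\,dy,\quad \hat x\in\mathbb S^{d-1},\qquad \beta_2=\frac{e^{\mathrm i\pi/4}}{\sqrt{8\pi}},\quad \beta_3=\frac1{4\pi},$$ be the far-field pattern of the stochastic polyharmonic wave equation $(-\Delta)^nu-k^{2n}u=f$ in $\mathbb R^d$ with the Sommerfeld radiation condition; the integral is the pairing of the compactly supported distribution $f$ with the smooth function $y\mapsto e^{\mathrm i k\hat x\cdot y}$. (Using the kernel $e^{-\mathrm i k\hat x\cdot y}$ instead amounts to replacing $\hat x$ by $-\hat x$.) Then, almost surely, $f\in H^{-\frac{d-m}2-\epsilon}(\mathbb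 R^d)$ for every $\epsilon>0$, and $u^\infty(\cdot,k)$ is bounded on $\mathbb S^{d-1}$: there is a finite (random) constant $C$ with $|u^\infty(\hat x,k)|\le C$ for all $\hat x\in\mathbb S^{d-1}$. -/

import Mathlib

open MeasureTheory ProbabilityTheory Filter Topology
open scoped SchwartzMap ContDiff ENNReal Distributions RealInnerProductSpace

noncomputable section

namespace RandomSource

/-- The Euclidean space `ℝ^d`. -/
abbrev Space (d : ℕ) : Type := EuclideanSpace ℝ (Fin d)

/-- The real test functions `C_c^∞(ℝ^d; ℝ)`. -/
abbrev RealTest (d : ℕ) : Type := 𝓓((⊤ : TopologicalSpace.Opens (Space d)), ℝ)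

/-- A real test function, seen as a complex-valued Schwartz function. -/
def RealTest.toSchwartz {d : ℕ} (φ : RealTest d) : 𝓢(Space d, ℂ) :=
  HasCompactSupport.toSchwartzMap (f := fun x => ((φ x : ℝ) : ℂ))
    (φ.hasCompactSupport.comp_left (g := fun t : ℝ => (t : ℂ)) Complex.ofReal_zero)
    (Complex.ofRealCLM.contDiff.comp φ.contDiff)

/-! ### Function spaces and symbols -/

/-- `g ∈ W₀^{s,p}(B₁)`, where `B₁` is the open unit ball: `g` (extended by zero outside `B₁`) is the
`L^p` limit of a sequence of functions in `C_c^∞(B₁)` that is Cauchy in the norm of `W^{s,p}`.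
The derivatives of the sequence then converge in `L^p` to the weak derivatives of `g`. -/
def MemW0 {d : ℕ} (s : ℕ) (p : ℝ≥0∞) (g : Space d → ℝ) : Prop :=
  AEStronglyMeasurable g volume ∧
  ∃ φ : ℕ → Space d → ℝ,
    (∀ j, ContDiff ℝ ∞ (φ j) ∧ HasCompactSupport (φ j) ∧
      tsupport (φ j) ⊆ Metric.ball (0 : Space d) 1) ∧
    Tendsto (fun j => eLpNorm (fun x => φ j x - g x) p volume) atTop (𝓝 0) ∧
    ∀ i ≤ s, Tendsto
      (fun q : ℕ × ℕ => eLpNorm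
        (fun x => iteratedFDeriv ℝ i (φ q.1) x - iteratedFDeriv ℝ i (φ q.2) x) p volume)
      atTop (𝓝 0)

/-- The symbol class `S^μ(ℝ^d × ℝ^d)`: smooth functions `c(x, ξ)` all of whose derivatives satisfy
`|∂_x^α ∂_ξ^β c(x, ξ)| ≤ C_{α,β} (1 + |ξ|²)^{(μ - |β|)/2}`. -/
def IsSymbol {d : ℕ} (μ : ℝ) (c : Space d → Space d → ℂ) : Prop :=
  ContDiff ℝ ∞ (fun z : Space d × Space d => c z.1 z.2) ∧
  ∀ a b : ℕ, ∃ C : ℝ, ∀ x ξ : Space d,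
    ‖iteratedFDeriv ℝ a (fun x' => iteratedFDeriv ℝ b (fun ξ' => c x' ξ') ξ) x‖
      ≤ C * (1 + ‖ξ‖ ^ 2) ^ ((μ - b) / 2)

/-- The Fourier transform `φ̂(ξ) = ∫ φ(y) e^{-i y·ξ} dy`. -/
def fourierHat {d : ℕ} (φ : Space d → ℝ) (ξ : Space d) : ℂ :=
  ∫ y, (φ y : ℂ) * Complex.exp (-Complex.I * (⟪y, ξ⟫ : ℝ))

/-- The operator with symbol `c`:
`(Qφ)(x) = (2π)^{-d} ∫ e^{i x·ξ} c(x, ξ) φ̂(ξ) dξ`. -/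
def opOfSymbol {d : ℕ} (c : Space d → Space d → ℂ) (φ : Space d → ℝ) (x : Space d) : ℂ :=
  (((2 * Real.pi) ^ d : ℝ) : ℂ)⁻¹ *
    ∫ ξ, Complex.exp (Complex.I * (⟪x, ξ⟫ : ℝ)) * c x ξ * fourierHat φ ξ

/-- `h` is the homogeneous function `|ξ|^{-m}` up to a modification in a bounded region which makes
it locally integrable. For `m < d` one may take `h(ξ) = |ξ|^{-m}` itself; for `m = d` this function
is not integrable near `ξ = 0`, and one may take for instance `(1 - χ(ξ)) |ξ|^{-m}` with a
compactly supported cutoff `χ` equal to `1` near `0`. -/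
def IsPowerAtInfinity {d : ℕ} (m : ℝ) (h : Space d → ℝ) : Prop :=
  LocallyIntegrable h volume ∧
  ∀ᶠ ξ in Bornology.cobounded (Space d), h ξ = ‖ξ‖ ^ (-m)

/-- The symbols `c(x, ξ) = σ(x) |ξ|^{-m} + r(x, ξ)` with `r ∈ S^{-m-1}` and `r(·, ξ) ∈ C_c^∞(B₁)`
for every `ξ`, the low frequencies of `|ξ|^{-m}` being understood as in `IsPowerAtInfinity`. -/
def HasIsotropicPrincipalPart {d : ℕ} (m : ℝ) (σ : Space d → ℝ)
    (c : Space d → Space d → ℂ) : Prop :=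
  ∃ (h : Space d → ℝ) (r : Space d → Space d → ℂ),
    IsPowerAtInfinity m h ∧
    IsSymbol (-m - 1) r ∧
    (∀ ξ, HasCompactSupport (fun x => r x ξ) ∧
      tsupport (fun x => r x ξ) ⊆ Metric.ball (0 : Space d) 1) ∧
    ∀ x ξ, c x ξ = ((σ x * h ξ : ℝ) : ℂ) + r x ξ

/-! ### The random source -/

/-- The real random variable `⟨f, φ⟩` of a real-valued random distribution `f`. -/
def pairReal {Ω : Type*} {d : ℕ} (f : Ω → 𝓢'(Space d, ℂ)) (φ : RealTest d) (w : Ω) : ℝ :=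
  (f w φ.toSchwartz).re

/-- `f` is a real-valued, centered, generalized Gaussian random field on `ℝ^d`, supported in the
(closed) unit ball, which is microlocally isotropic of order `-m` with strength `σ`: its covariance
operator, `⟨Q_f φ, ψ⟩ = 𝔼[⟨f, φ⟩⟨f, ψ⟩]`, has a symbol `σ(x)|ξ|^{-m} + r(x, ξ)`.
As its realizations have compact support, they are tempered distributions. -/
structure IsGMIGField {Ω : Type*} [MeasurableSpace Ω] (P : Measure Ω) {d : ℕ}
    (m : ℝ) (σ : Space d → ℝ) (f : Ω → 𝓢'(Space d, ℂ)) : Prop where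
  /-- `f` is real-valued -/
  real : ∀ᵐ w ∂P, ∀ φ : RealTest d, (f w φ.toSchwartz).im = 0
  /-- `f` is supported in the closed unit ball -/
  supp : ∀ᵐ w ∂P, Distribution.IsVanishingOn (f w) (Metric.closedBall (0 : Space d) 1)ᶜ
  /-- `f` is a generalized Gaussian field -/
  gaussian : IsGaussianProcess (pairReal f) P
  /-- `f` is centered -/
  centered : ∀ φ : RealTest d, ∫ w, pairReal f φ w ∂P = 0
  /-- the covariance operator is given by a symbol with principal part `σ(x)|ξ|^{-m}` -/
  covariance : ∃ c : Space d → Space d → ℂ, HasIsotropicPrincipalPart m σ c ∧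
    ∀ φ ψ : RealTest d,
      ((∫ w, pairReal f φ w * pairReal f ψ w ∂P : ℝ) : ℂ) =
        ∫ x, opOfSymbol c φ x * (ψ x : ℂ)

/-- The standing assumption on the random source of the polyharmonic wave equation
`(-Δ)^n u - k^{2n} u = f` in `ℝ^d`. -/
structure IsAdmissibleSource {Ω : Type*} [MeasurableSpace Ω] (P : Measure Ω) {d : ℕ}
    (n : ℕ) (m : ℝ) (s : ℕ) (σ : Space d → ℝ) (f : Ω → 𝓢'(Space d, ℂ)) : Prop where
  lt_order : (d : ℝ) + 2 - 4 * n < m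
  order_le : m ≤ d
  lt_smoothness : (d : ℝ) / 4 + 2 * n - 1 < s
  strength_nonneg : ∀ x, 0 ≤ σ x
  sqrt_strength : MemW0 s 4 (fun x => Real.sqrt (σ x))
  field : IsGMIGField P m σ f

/-! ### The far-field pattern -/

/-- A smooth cutoff function, equal to `1` on the ball of radius `2` and to `0` outside the ball of
radius `3`. -/
def cutoff (d : ℕ) : ContDiffBump (0 : Space d) := ⟨2, 3, by norm_num, by norm_num⟩

/-- The compactly supported smooth function `χ p`, as a Schwartz function. -/
def localize {d : ℕ} (χ : Space d → ℝ) (hχ : ContDiff ℝ ∞ χ) (hχc : HasCompactSupport χ)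
    (p : Space d → ℂ) (hp : ContDiff ℝ ∞ p) : 𝓢(Space d, ℂ) :=
  HasCompactSupport.toSchwartzMap (f := fun y => (χ y : ℂ) * p y)
    (HasCompactSupport.mul_right
      (f := fun y => (χ y : ℂ))
      (hχc.comp_left (g := fun t : ℝ => (t : ℂ)) Complex.ofReal_zero))
    ((Complex.ofRealCLM.contDiff.comp hχ).mul hp)

/-- The pairing `∫ p(y) T(y) dy` of a distribution `T` supported in the closed unit ball with a
smooth function `p`, that is, `⟨T, χ p⟩` for any smooth, compactly supported `χ` equal to `1` near
the closed unit ball; `pairSmooth_eq` says that the choice of `χ` is immaterial. -/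
def pairSmooth {d : ℕ} (T : 𝓢'(Space d, ℂ)) (p : Space d → ℂ) (hp : ContDiff ℝ ∞ p) : ℂ :=
  T (localize (cutoff d) (cutoff d).contDiff (cutoff d).hasCompactSupport p hp)

theorem pairSmooth_eq {d : ℕ} (T : 𝓢'(Space d, ℂ))
    (hT : Distribution.IsVanishingOn T (Metric.closedBall (0 : Space d) 1)ᶜ)
    (p : Space d → ℂ) (hp : ContDiff ℝ ∞ p)
    (χ : Space d → ℝ) (hχ : ContDiff ℝ ∞ χ) (hχc : HasCompactSupport χ)
    (h1 : ∀ x ∈ Metric.closedBall (0 : Space d) 1, ∀ᶠ y in 𝓝 x, χ y = 1) :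
    pairSmooth T p hp = T (localize χ hχ hχc p hp) := by
  rw [← sub_eq_zero, pairSmooth, ← map_sub]
  apply hT
  intro x hx hxb
  apply (notMem_tsupport_iff_eventuallyEq.mpr _) hx
  have h2 : ∀ᶠ y in 𝓝 x, y ∈ Metric.ball (0 : Space d) 2 :=
    Metric.isOpen_ball.mem_nhds (by
      simp only [Metric.mem_closedBall, Metric.mem_ball] at hxb ⊢
      linarith)
  filter_upwards [h1 x hxb, h2] with y hy hy2
  have hc : cutoff d y = 1 :=
    (cutoff d).one_of_mem_closedBall (Metric.ball_subset_closedBall hy2)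
  change ((cutoff d y : ℝ) : ℂ) * p y - ((χ y : ℝ) : ℂ) * p y = 0
  rw [hc, hy, sub_self]

/-- The plane wave `y ↦ e^{i k x̂·y}`. -/
def planeWave {d : ℕ} (k : ℝ) (xhat : Space d) (y : Space d) : ℂ :=
  Complex.exp (Complex.I * ((k * ⟪xhat, y⟫ : ℝ) : ℂ))

theorem contDiff_planeWave {d : ℕ} (k : ℝ) (xhat : Space d) :
    ContDiff ℝ ∞ (planeWave k xhat) := by
  have h : ContDiff ℝ ∞ (fun y : Space d => k * ⟪xhat, y⟫) :=
    contDiff_const.mul (contDiff_const.inner ℝ contDiff_id)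
  exact (contDiff_const.mul (Complex.ofRealCLM.contDiff.comp h)).cexp

/-- The constant `β_d`: it is `e^{iπ/4} / √(8π)` for `d = 2` and `1 / (4π)` for `d = 3` (the only two
dimensions that are used). -/
def beta (d : ℕ) : ℂ :=
  if d = 2 then Complex.exp (Complex.I * (Real.pi / 4)) / (Real.sqrt (8 * Real.pi) : ℂ)
  else 1 / (4 * Real.pi)

/-- The far-field pattern
`u^∞(x̂, k) = -(β_d / n) k^{(d+1-4n)/2} ∫ e^{i k x̂·y} f(y) dy` of a realization `T` of the source. -/
def farField {d : ℕ} (n : ℕ) (k : ℝ) (T : 𝓢'(Space d, ℂ)) (xhat : Space d) : ℂ :=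
  -(beta d / n) * ((k ^ (((d : ℝ) + 1 - 4 * n) / 2) : ℝ) : ℂ) *
    pairSmooth T (planeWave k xhat) (contDiff_planeWave k xhat)

end RandomSource

end

noncomputable section

namespace RandomSource

open FourierTransform VectorFourier

variable {d : ℕ}

/-! ### Pairing a compactly supported distribution with smooth functions -/

/-! The two conclusions have independent reasons. Boundedness of the far field is deterministic: a
tempered distribution has finite order, so after the cutoff its pairing with a smooth function is
controlled by finitely many derivatives on a fixed ball (`exists_norm_pairSmooth_le`). At fixed `k`,
the derivatives of the plane waves are bounded uniformly over unit directions.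

Sobolev regularity comes from second moments. For a realization `T` supported in the closed unit
ball, the Fourier transform is the continuous function `fourierFun T ξ = ⟨T, χ e^{-2πi ξ·y}⟩`
(`pairSmooth_fourier`). Its real and imaginary parts are pairings of the field with real test
functions, so the covariance operator gives its mean square. The Fourier transform of such a test
function is concentrated near `±2πξ` with rapid decay, and the symbol is dominated by `(σ(x) + |A|)
|G(η)|` with `G` of order `-m` at infinity. Hence `𝔼|fourierFun f ξ|² ≤ C (1 + |ξ|²)^{-m/2}`
(`exists_lintegral_fourierFun_le`). With the weight `(1 + |ξ|²)^a`, `a = -(d-m)/2 - ε`, the bound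
becomes `(1 + |ξ|²)^{-d/2-ε}`, which is integrable. By Tonelli the weighted `L²` norm is almost
surely finite, which is membership in `H^a`. Sequences `ε → 0` make the exceptional null set
independent of `ε`. -/

theorem localize_apply (χ : Space d → ℝ) (hχ : ContDiff ℝ ∞ χ) (hχc : HasCompactSupport χ)
    (p : Space d → ℂ) (hp : ContDiff ℝ ∞ p) (y : Space d) :
    localize χ hχ hχc p hp y = (χ y : ℂ) * p y := rfl

theorem exists_iteratedFDeriv_cutoff_bound (d N : ℕ) :
    ∃ K : ℝ, 0 ≤ K ∧ ∀ i ≤ N, ∀ x : Space d,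
      ‖iteratedFDeriv ℝ i (fun y => ((cutoff d y : ℝ) : ℂ)) x‖ ≤ K := by
  have hs : ContDiff ℝ ∞ (fun y => ((cutoff d y : ℝ) : ℂ)) :=
    Complex.ofRealCLM.contDiff.comp (cutoff d).contDiff
  have hc : HasCompactSupport (fun y => ((cutoff d y : ℝ) : ℂ)) :=
    (cutoff d).hasCompactSupport.comp_left (g := fun t : ℝ => (t : ℂ)) Complex.ofReal_zero
  have h : ∀ i : ℕ, ∃ K : ℝ, ∀ x : Space d,
      ‖iteratedFDeriv ℝ i (fun y => ((cutoff d y : ℝ) : ℂ)) x‖ ≤ K := fun i =>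
    (hs.continuous_iteratedFDeriv (by exact_mod_cast le_top)).bounded_above_of_compact_support
      (hc.iteratedFDeriv i)
  choose K hK using h
  have hK0 : ∀ i, 0 ≤ K i := fun i => (norm_nonneg _).trans (hK i 0)
  refine ⟨∑ i ∈ Finset.range (N + 1), K i, Finset.sum_nonneg fun i _ => hK0 i, fun i hi x => ?_⟩
  exact (hK i x).trans (Finset.single_le_sum (f := K) (fun j _ => hK0 j)
    (Finset.mem_range.mpr (by omega)))

/-- The Schwartz seminorms of `χ p` are controlled by the derivatives of `p` on a ball. -/
theorem exists_seminorm_localize_le (d k n : ℕ) :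
    ∃ C : ℝ, 0 ≤ C ∧ ∀ (p : Space d → ℂ) (hp : ContDiff ℝ ∞ p) (M : ℝ),
      (∀ i ≤ n, ∀ x ∈ Metric.closedBall (0 : Space d) 3, ‖iteratedFDeriv ℝ i p x‖ ≤ M) →
      SchwartzMap.seminorm ℂ k n
        (localize (cutoff d) (cutoff d).contDiff (cutoff d).hasCompactSupport p hp) ≤ C * M := by
  obtain ⟨K, hK0, hK⟩ := exists_iteratedFDeriv_cutoff_bound d n
  -- The factor `3 ^ k` bounds `‖x‖ ^ k` on the support of the cutoff; the sum is the Leibniz rule.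
  refine ⟨3 ^ k * ∑ i ∈ Finset.range (n + 1), (n.choose i : ℝ) * K, by positivity, ?_⟩
  intro p hp M hM
  have hM0 : 0 ≤ M := (norm_nonneg _).trans (hM 0 (Nat.zero_le _) 0 (by simp))
  have hs : ContDiff ℝ ∞ (fun y => ((cutoff d y : ℝ) : ℂ)) :=
    Complex.ofRealCLM.contDiff.comp (cutoff d).contDiff
  refine SchwartzMap.seminorm_le_bound ℂ k n _ (by positivity) fun x => ?_
  by_cases hx : x ∈ Metric.closedBall (0 : Space d) 3
  · have hx' : ‖x‖ ≤ 3 := by simpa using hx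
    have h1 := norm_iteratedFDeriv_mul_le hs hp x (n := n) (by exact_mod_cast le_top)
    have h2 : ‖iteratedFDeriv ℝ n (localize (cutoff d) (cutoff d).contDiff
        (cutoff d).hasCompactSupport p hp) x‖ ≤
        ∑ i ∈ Finset.range (n + 1), (n.choose i : ℝ) * K * M := by
      refine h1.trans (Finset.sum_le_sum fun i hi => ?_)
      have := hK i (by simp at hi; omega) x
      have := hM (n - i) (by omega) x hx
      gcongr
    rw [mul_assoc, Finset.sum_mul]
    gcongr
  · have h0 : iteratedFDeriv ℝ n (localize (cutoff d) (cutoff d).contDiff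
        (cutoff d).hasCompactSupport p hp) x = 0 := by
      by_contra hne
      apply hx
      have h1 := support_iteratedFDeriv_subset n hne
      have h2 : tsupport (fun y => (cutoff d y : ℂ) * p y) ⊆ tsupport (cutoff d) := by
        refine closure_mono fun y hy => ?_
        intro h0
        apply hy
        simp [h0]
      have h3 := h2 h1
      rwa [(cutoff d).tsupport_eq] at h3
    rw [h0, norm_zero, mul_zero]
    positivity

/-- Continuity on Schwartz space means domination by finitely many seminorms, and on functions `χ p`
these see only derivatives of `p` on the ball of radius `3`. The cutoff is built into `pairSmooth`,
so `T` needs no support condition. -/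
theorem exists_norm_pairSmooth_le (T : 𝓢'(Space d, ℂ)) :
    ∃ (N : ℕ) (C : ℝ), 0 ≤ C ∧ ∀ (p : Space d → ℂ) (hp : ContDiff ℝ ∞ p) (M : ℝ),
      (∀ i ≤ N, ∀ x ∈ Metric.closedBall (0 : Space d) 3, ‖iteratedFDeriv ℝ i p x‖ ≤ M) →
      ‖pairSmooth T p hp‖ ≤ C * M := by
  let q : Seminorm ℂ 𝓢(Space d, ℂ) := (normSeminorm ℂ ℂ).comp T.toLinearMap
  have hq : Continuous q := continuous_norm.comp (map_continuous T)
  obtain ⟨s, C, -, hC⟩ := Seminorm.bound_of_continuous (schwartz_withSeminorms ℂ (Space d) ℂ) q hq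
  choose K hK0 hK using fun i : ℕ × ℕ => exists_seminorm_localize_le d i.1 i.2
  -- `N` is the highest derivative order among the finitely many seminorms.
  refine ⟨s.sup Prod.snd, C * ∑ i ∈ s, K i,
    mul_nonneg C.coe_nonneg (Finset.sum_nonneg fun i _ => hK0 i), fun p hp M hM => ?_⟩
  have hM0 : 0 ≤ M := (norm_nonneg _).trans (hM 0 (Nat.zero_le _) 0 (by simp))
  have h1 := hC (localize (cutoff d) (cutoff d).contDiff (cutoff d).hasCompactSupport p hp)
  refine h1.trans ?_
  rw [mul_assoc]
  change (C : ℝ) * _ ≤ _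
  refine mul_le_mul_of_nonneg_left ?_ C.coe_nonneg
  refine Seminorm.finset_sup_apply_le
    (mul_nonneg (Finset.sum_nonneg fun i _ => hK0 i) hM0) fun i hi => ?_
  refine (hK i p hp M fun j hj => hM j (hj.trans (Finset.le_sup (f := Prod.snd) hi))).trans ?_
  exact mul_le_mul_of_nonneg_right
    (Finset.single_le_sum (f := K) (fun j _ => hK0 j) hi) hM0

/-! ### Derivatives of plane waves -/

theorem iteratedDeriv_cexp_ofReal_mul (n : ℕ) (c : ℂ) :
    iteratedDeriv n (fun t : ℝ => Complex.exp (c * t)) = fun t : ℝ => c ^ n * Complex.exp (c * t) := by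
  induction n with
  | zero => simp
  | succ n ih =>
    rw [iteratedDeriv_succ, ih]
    ext t
    have h : HasDerivAt (fun t : ℝ => c * (t : ℂ)) c t := by
      simpa using (Complex.ofRealCLM.hasDerivAt (x := t)).const_mul c
    rw [(h.cexp.const_mul (c ^ n)).deriv]
    ring

/-- The coefficient of the `i`-th derivative of the plane wave `x ↦ e^{-2π i ξ·x}`. -/
def waveCoeff (i : ℕ) (ξ : Space d) : Space d [×i]→L[ℝ] ℂ :=
  fourierPowSMulRight (innerSL ℝ) (fun _ => (1 : ℂ)) ξ i

theorem continuous_waveCoeff (i : ℕ) : Continuous (waveCoeff (d := d) i) :=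
  Continuous.fourierPowSMulRight _ continuous_const i

theorem norm_waveCoeff_le (i : ℕ) (ξ : Space d) :
    ‖waveCoeff i ξ‖ ≤ (2 * Real.pi) ^ i * ‖ξ‖ ^ i := by
  refine (norm_fourierPowSMulRight_le _ _ ξ i).trans ?_
  rw [norm_one, mul_one]
  have : ‖(innerSL ℝ : Space d →L[ℝ] Space d →L[ℝ] ℝ)‖ ≤ 1 := norm_innerSL_le _
  have hpi := Real.pi_pos
  have : 2 * Real.pi * ‖(innerSL ℝ : Space d →L[ℝ] Space d →L[ℝ] ℝ)‖ ≤ 2 * Real.pi := by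
    nlinarith
  gcongr

/-- The wave is a one-variable exponential composed with a linear form. Writing the coefficient
through `fourierPowSMulRight` matches Mathlib's formula for derivatives of a Fourier transform, used
in `integral_smul_jet_wave`. -/
theorem iteratedFDeriv_planeWave (i : ℕ) (ξ x : Space d) :
    iteratedFDeriv ℝ i (planeWave (-2 * Real.pi) ξ) x =
      planeWave (-2 * Real.pi) ξ x • waveCoeff i ξ := by
  let c : ℂ := -(2 * Real.pi * Complex.I)
  have h1 : planeWave (-2 * Real.pi) ξ = (fun t : ℝ => Complex.exp (c * t)) ∘ (innerSL ℝ ξ) := by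
    ext y
    simp only [planeWave, Function.comp_apply, innerSL_apply_apply, c]
    congr 1
    push_cast
    ring
  have h2 : ContDiff ℝ ∞ (fun t : ℝ => Complex.exp (c * t)) :=
    (contDiff_const.mul Complex.ofRealCLM.contDiff).cexp
  rw [h1, ContinuousLinearMap.iteratedFDeriv_comp_right _ h2 x (i := i) (by exact_mod_cast le_top)]
  ext v
  rw [ContinuousMultilinearMap.compContinuousLinearMap_apply,
    iteratedFDeriv_apply_eq_iteratedDeriv_mul_prod, iteratedDeriv_cexp_ofReal_mul]
  simp only [waveCoeff, smul_apply, fourierPowSMulRight_apply,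
    Function.comp_apply, c]
  simp only [smul_eq_mul, Complex.real_smul, mul_one]
  ring

theorem norm_planeWave (k : ℝ) (ξ x : Space d) : ‖planeWave k ξ x‖ = 1 := by
  rw [planeWave, mul_comm]
  exact Complex.norm_exp_ofReal_mul_I _

theorem norm_iteratedFDeriv_planeWave_le (i : ℕ) (ξ x : Space d) :
    ‖iteratedFDeriv ℝ i (planeWave (-2 * Real.pi) ξ) x‖ ≤ (2 * Real.pi) ^ i * ‖ξ‖ ^ i := by
  rw [iteratedFDeriv_planeWave, norm_smul, norm_planeWave, one_mul]
  exact norm_waveCoeff_le i ξ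

theorem planeWave_eq_rescale (k : ℝ) (ξ : Space d) :
    planeWave k ξ = planeWave (-2 * Real.pi) ((-(k / (2 * Real.pi))) • ξ) := by
  ext y
  simp only [planeWave, inner_smul_left]
  congr 3
  have := Real.pi_pos.ne'
  simp
  field_simp

/-- The far-field pattern of a tempered distribution is bounded. -/
theorem exists_norm_farField_le (n : ℕ) (k : ℝ) (T : 𝓢'(Space d, ℂ)) :
    ∃ C : ℝ, ∀ xhat ∈ Metric.sphere (0 : Space d) 1, ‖farField n k T xhat‖ ≤ C := by
  obtain ⟨N, C, hC0, hC⟩ := exists_norm_pairSmooth_le T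
  -- After rescaling the frequency by `-k/(2π)`, the factors `2π` cancel and the `i`-th derivative
  -- is at most `|k| ^ i`; `(1 + |k|) ^ N` dominates all orders `i ≤ N`.
  refine ⟨‖-(beta d / n) * ((k ^ (((d : ℝ) + 1 - 4 * n) / 2) : ℝ) : ℂ)‖ * (C * (1 + |k|) ^ N),
    fun xhat hx => ?_⟩
  rw [farField, norm_mul]
  refine mul_le_mul_of_nonneg_left (hC _ _ _ fun i hi y _ => ?_) (norm_nonneg _)
  rw [planeWave_eq_rescale]
  refine (norm_iteratedFDeriv_planeWave_le i _ y).trans ?_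
  have hx1 : ‖xhat‖ = 1 := by simpa using hx
  rw [norm_smul, hx1, mul_one, norm_neg, ← mul_pow, norm_div]
  have hp : ‖2 * Real.pi‖ = 2 * Real.pi := by
    rw [Real.norm_eq_abs, abs_of_pos (by positivity)]
  rw [hp, mul_div_cancel₀ _ (by positivity), Real.norm_eq_abs]
  calc |k| ^ i ≤ (1 + |k|) ^ i := by gcongr; linarith
    _ ≤ (1 + |k|) ^ N := pow_le_pow_right₀ (by linarith [abs_nonneg k]) hi

/-! ### The Fourier transform of a compactly supported distribution -/

/-- A linear functional that is bounded in terms of a linear map factors continuously. -/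
theorem exists_continuousLinear_factor {V E : Type*} [AddCommGroup V] [Module ℂ V]
    [NormedAddCommGroup E] [NormedSpace ℂ E] (J : V →ₗ[ℂ] E) (Λ : V →ₗ[ℂ] ℂ) (C : ℝ)
    (h : ∀ v, ‖Λ v‖ ≤ C * ‖J v‖) : ∃ Φ : E →L[ℂ] ℂ, ∀ v, Φ (J v) = Λ v := by
  have hker : LinearMap.ker J ≤ LinearMap.ker Λ := fun v hv => by
    have h1 := h v
    rw [LinearMap.mem_ker.mp hv, norm_zero, mul_zero] at h1
    exact LinearMap.mem_ker.mpr (norm_le_zero_iff.mp h1)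
  let Λ' : LinearMap.range J →ₗ[ℂ] ℂ :=
    ((LinearMap.ker J).liftQ Λ hker) ∘ₗ J.quotKerEquivRange.symm.toLinearMap
  have hΛ' : ∀ v, Λ' ⟨J v, LinearMap.mem_range_self J v⟩ = Λ v := fun v => by
    have : J.quotKerEquivRange.symm ⟨J v, LinearMap.mem_range_self J v⟩ =
        Submodule.Quotient.mk v := by
      rw [LinearEquiv.symm_apply_eq]
      rfl
    simp only [Λ', LinearMap.comp_apply, LinearEquiv.coe_coe]
    rw [this]
    exact Submodule.liftQ_apply _ _ _
  let Λc : LinearMap.range J →L[ℂ] ℂ := Λ'.mkContinuous C (by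
    rintro ⟨_, v, rfl⟩
    rw [hΛ']
    exact h v)
  -- Hahn–Banach extends the bounded functional from the range of `J` to all of `E`.
  obtain ⟨Φ, hΦ, -⟩ := exists_extension_norm_eq (LinearMap.range J) Λc
  exact ⟨Φ, fun v => (hΦ ⟨J v, LinearMap.mem_range_self J v⟩).trans (hΛ' v)⟩

/-- The space of smooth functions. -/
def smoothFunctions (d : ℕ) : Submodule ℂ (Space d → ℂ) where
  carrier := {p | ContDiff ℝ ∞ p}
  add_mem' {_ _} hp hq := by
    rw [Set.mem_ofPred_eq] at *
    exact hp.add hq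
  zero_mem' := by
    rw [Set.mem_ofPred_eq]
    exact contDiff_const
  smul_mem' c _ hp := by
    rw [Set.mem_ofPred_eq] at *
    exact contDiff_const.smul hp

theorem mem_smoothFunctions {p : Space d → ℂ} : p ∈ smoothFunctions d ↔ ContDiff ℝ ∞ p := Iff.rfl

theorem contDiff_coe (p : smoothFunctions d) : ContDiff ℝ ∞ (p : Space d → ℂ) :=
  mem_smoothFunctions.mp p.2

/-- The target of the jets of order `N` on a closed ball. -/
abbrev JetSpace (d N : ℕ) : Type :=
  (i : Fin (N + 1)) → C(Metric.closedBall (0 : Space d) 3, Space d [×i]→L[ℝ] ℂ)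

instance (d N : ℕ) : NormedAddCommGroup (JetSpace d N) := Pi.normedAddCommGroup

instance (d N : ℕ) : NormedSpace ℂ (JetSpace d N) := Pi.normedSpace

/-- Lets continuous maps from `Space d` into the jet space be strongly measurable, as Bochner
integration requires. -/
instance (d N : ℕ) : SecondCountableTopologyEither (Space d) (JetSpace d N) :=
  ⟨Or.inl inferInstance⟩

/-- The jet of order `N` of a smooth function on a closed ball. -/
def jet (d N : ℕ) : smoothFunctions d →ₗ[ℂ] JetSpace d N where
  toFun p i := ⟨fun x => iteratedFDeriv ℝ i p.1 x,
    (ContDiff.continuous_iteratedFDeriv (m := (i : ℕ)) (by exact_mod_cast le_top) (contDiff_coe p)).comp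
      continuous_subtype_val⟩
  map_add' p q := by
    ext i x : 2
    exact iteratedFDeriv_add_apply ((contDiff_coe p).of_le (by exact_mod_cast le_top)).contDiffAt
      ((contDiff_coe q).of_le (by exact_mod_cast le_top)).contDiffAt
  map_smul' c p := by
    ext i x : 2
    exact iteratedFDeriv_const_smul_apply ((contDiff_coe p).of_le (by exact_mod_cast le_top)).contDiffAt

theorem jet_apply (N : ℕ) (p : smoothFunctions d) (i : Fin (N + 1))
    (x : Metric.closedBall (0 : Space d) 3) : jet d N p i x = iteratedFDeriv ℝ i p.1 x := rfl

/-- `pairSmooth T` as a linear functional. -/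
def pairSmoothₗ (T : 𝓢'(Space d, ℂ)) : smoothFunctions d →ₗ[ℂ] ℂ where
  toFun p := pairSmooth T p.1 (contDiff_coe p)
  map_add' p q := by
    simp only [pairSmooth, ← map_add]
    congr 1
    ext y
    simp [localize_apply, mul_add]
  map_smul' c p := by
    simp only [pairSmooth, RingHom.id_apply, ← map_smul]
    congr 1
    ext y
    simp [localize_apply]
    ring

/-- The pairing with smooth functions is a continuous functional of a jet. -/
theorem exists_pairSmooth_eq_jet (T : 𝓢'(Space d, ℂ)) :
    ∃ (N : ℕ) (Φ : JetSpace d N →L[ℂ] ℂ), ∀ p : smoothFunctions d,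
      Φ (jet d N p) = pairSmooth T p.1 (contDiff_coe p) := by
  obtain ⟨N, C, hC0, hC⟩ := exists_norm_pairSmooth_le T
  obtain ⟨Φ, hΦ⟩ := exists_continuousLinear_factor (jet d N) (pairSmoothₗ T) C fun p =>
    hC p.1 (contDiff_coe p) _ fun i hi x hx => by
      have h1 := (jet d N p ⟨i, by omega⟩).norm_coe_le_norm ⟨x, hx⟩
      exact h1.trans (norm_le_pi_norm (jet d N p) ⟨i, by omega⟩)
  exact ⟨N, Φ, hΦ⟩

/-- The plane wave as a smooth function. -/
def wave (ξ : Space d) : smoothFunctions d :=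
  ⟨planeWave (-2 * Real.pi) ξ, mem_smoothFunctions.mpr (contDiff_planeWave _ ξ)⟩

/-- The Fourier transform of a compactly supported distribution, as a function. -/
def fourierFun (T : 𝓢'(Space d, ℂ)) (ξ : Space d) : ℂ :=
  pairSmooth T (planeWave (-2 * Real.pi) ξ) (contDiff_planeWave _ ξ)

theorem continuous_jet_wave (N : ℕ) : Continuous fun ξ : Space d => jet d N (wave ξ) := by
  refine continuous_pi fun i => ContinuousMap.continuous_of_continuous_uncurry _ ?_
  have h : Continuous fun z : Space d × Metric.closedBall (0 : Space d) 3 =>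
      planeWave (-2 * Real.pi) z.1 (z.2 : Space d) • waveCoeff (i : ℕ) z.1 := by
    have h1 : Continuous fun z : Space d × Metric.closedBall (0 : Space d) 3 =>
        planeWave (-2 * Real.pi) z.1 (z.2 : Space d) := by
      unfold planeWave
      fun_prop
    have h2 : Continuous fun z : Space d × Metric.closedBall (0 : Space d) 3 =>
        waveCoeff (i : ℕ) z.1 := (continuous_waveCoeff (i : ℕ)).comp continuous_fst
    exact h1.smul h2
  refine h.congr fun z => ?_
  exact (iteratedFDeriv_planeWave _ _ _).symm

/-- Polynomial growth in `ξ` is what makes the jets of waves integrable against a Schwartz function.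
-/
theorem norm_jet_wave_le (N : ℕ) (ξ : Space d) :
    ‖jet d N (wave ξ)‖ ≤ (2 * Real.pi) ^ N * (1 + ‖ξ‖) ^ N := by
  refine (pi_norm_le_iff_of_nonneg (by positivity)).mpr fun i => ?_
  refine (ContinuousMap.norm_le _ (by positivity)).mpr fun x => ?_
  refine (norm_iteratedFDeriv_planeWave_le _ _ _).trans ?_
  have hi : (i : ℕ) ≤ N := by omega
  have hpi : (1 : ℝ) ≤ 2 * Real.pi := by linarith [Real.pi_gt_three]
  refine mul_le_mul (pow_le_pow_right₀ hpi hi) ?_ (by positivity) (by positivity)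
  calc ‖ξ‖ ^ (i : ℕ) ≤ (1 + ‖ξ‖) ^ (i : ℕ) := by gcongr; linarith
    _ ≤ (1 + ‖ξ‖) ^ N := pow_le_pow_right₀ (by linarith [norm_nonneg ξ]) hi

theorem continuous_fourierFun (T : 𝓢'(Space d, ℂ)) : Continuous (fourierFun T) := by
  obtain ⟨N, Φ, hΦ⟩ := exists_pairSmooth_eq_jet T
  have : fourierFun T = fun ξ => Φ (jet d N (wave ξ)) := by
    ext ξ
    exact (hΦ (wave ξ)).symm
  rw [this]
  exact Φ.continuous.comp (continuous_jet_wave N)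

theorem integrable_one_add_norm_pow_mul (φ : 𝓢(Space d, ℂ)) (N : ℕ) :
    Integrable fun ξ => (1 + ‖ξ‖) ^ N * ‖φ ξ‖ := by
  have h : ∀ k : ℕ, Integrable fun ξ => ‖ξ‖ ^ k * ‖φ ξ‖ := fun k => φ.integrable_pow_mul volume k
  have : (fun ξ : Space d => (1 + ‖ξ‖) ^ N * ‖φ ξ‖) =
      fun ξ => ∑ k ∈ Finset.range (N + 1), (N.choose k : ℝ) * (‖ξ‖ ^ k * ‖φ ξ‖) := by
    ext ξ
    rw [add_comm, add_pow, Finset.sum_mul]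
    refine Finset.sum_congr rfl fun k _ => ?_
    rw [one_pow]
    ring
  rw [this]
  exact integrable_finsetSum _ fun k _ => (h k).const_mul _

theorem integrable_smul_jet_wave (φ : 𝓢(Space d, ℂ)) (N : ℕ) :
    Integrable fun ξ => φ ξ • jet d N (wave ξ) := by
  refine ((integrable_one_add_norm_pow_mul φ N).const_mul ((2 * Real.pi) ^ N)).mono'
    (φ.continuous.smul (continuous_jet_wave N)).aestronglyMeasurable (ae_of_all _ fun ξ => ?_)
  rw [norm_smul]
  have := norm_jet_wave_le N ξ
  calc ‖φ ξ‖ * ‖jet d N (wave ξ)‖ ≤ ‖φ ξ‖ * ((2 * Real.pi) ^ N * (1 + ‖ξ‖) ^ N) := by gcongr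
    _ = _ := by ring

/-- The Fourier transform of a Schwartz function as a smooth function. -/
def fourierSmooth (φ : 𝓢(Space d, ℂ)) : smoothFunctions d :=
  ⟨(𝓕 φ : 𝓢(Space d, ℂ)), mem_smoothFunctions.mpr ((𝓕 φ : 𝓢(Space d, ℂ)).smooth ⊤)⟩

/-- The Fourier integral, read as a Bochner integral of jets: evaluating each component at a point
reduces it to differentiation under the Fourier integral. -/
theorem integral_smul_jet_wave (φ : 𝓢(Space d, ℂ)) (N : ℕ) :
    ∫ ξ, φ ξ • jet d N (wave ξ) = jet d N (fourierSmooth φ) := by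
  ext i x : 2
  let ev : JetSpace d N →L[ℂ] (Space d [×i]→L[ℝ] ℂ) :=
    (ContinuousMap.evalCLM ℂ x).comp (ContinuousLinearMap.proj i)
  have h1 := ev.integral_comp_comm (integrable_smul_jet_wave φ N)
  have h2 : iteratedFDeriv ℝ i (𝓕 (φ : Space d → ℂ)) =
      𝓕 (fun v => fourierPowSMulRight (innerSL ℝ) φ v i) :=
    Real.iteratedFDeriv_fourier (N := ⊤) (fun n _ => φ.integrable_pow_mul volume n)
      φ.continuous.aestronglyMeasurable le_top
  rw [jet_apply]
  change ev (∫ ξ, φ ξ • jet d N (wave ξ)) = iteratedFDeriv ℝ i (𝓕 (φ : Space d → ℂ)) (x : Space d)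
  rw [← h1, h2, Real.fourier_eq]
  refine integral_congr_ae (ae_of_all _ fun ξ => ?_)
  have h3 : ev (φ ξ • jet d N (wave ξ)) =
      φ ξ • iteratedFDeriv ℝ i (planeWave (-2 * Real.pi) ξ) (x : Space d) := rfl
  simp only [h3, iteratedFDeriv_planeWave]
  ext v
  rw [Circle.smul_def]
  simp only [smul_apply, waveCoeff, fourierPowSMulRight_apply,
    smul_eq_mul, Complex.real_smul, Real.fourierChar_apply, planeWave]
  rw [show Complex.I * ((-2 * Real.pi * ⟪ξ, (x : Space d)⟫ : ℝ) : ℂ) =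
    ((2 * Real.pi * -⟪ξ, (x : Space d)⟫ : ℝ) : ℂ) * Complex.I by push_cast; ring]
  ring

/-- Through its factorization over jets, the pairing is a continuous functional on a Banach space
and so commutes with the integral of waves. -/
theorem pairSmooth_fourier (T : 𝓢'(Space d, ℂ)) (φ : 𝓢(Space d, ℂ)) :
    pairSmooth T (𝓕 φ : 𝓢(Space d, ℂ)) ((𝓕 φ : 𝓢(Space d, ℂ)).smooth ⊤) = ∫ ξ, φ ξ * fourierFun T ξ := by
  obtain ⟨N, Φ, hΦ⟩ := exists_pairSmooth_eq_jet T
  rw [show pairSmooth T (𝓕 φ : 𝓢(Space d, ℂ)) ((𝓕 φ : 𝓢(Space d, ℂ)).smooth ⊤) =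
    Φ (jet d N (fourierSmooth φ)) from (hΦ (fourierSmooth φ)).symm, ← integral_smul_jet_wave,
    ← Φ.integral_comp_comm (integrable_smul_jet_wave φ N)]
  refine integral_congr_ae (ae_of_all _ fun ξ => ?_)
  simp only [map_smul, smul_eq_mul]
  congr 1
  exact hΦ (wave ξ)

theorem apply_eq_pairSmooth (T : 𝓢'(Space d, ℂ))
    (hT : Distribution.IsVanishingOn T (Metric.closedBall (0 : Space d) 1)ᶜ) (φ : 𝓢(Space d, ℂ)) :
    T φ = pairSmooth T φ (φ.smooth ⊤) := by
  rw [← sub_eq_zero, pairSmooth, ← map_sub]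
  apply hT
  intro x hx hxb
  apply (notMem_tsupport_iff_eventuallyEq.mpr _) hx
  have h2 : ∀ᶠ y in 𝓝 x, y ∈ Metric.ball (0 : Space d) 2 :=
    Metric.isOpen_ball.mem_nhds (by
      simp only [Metric.mem_closedBall, Metric.mem_ball] at hxb ⊢
      linarith)
  filter_upwards [h2] with y hy2
  have hc : cutoff d y = 1 :=
    (cutoff d).one_of_mem_closedBall (Metric.ball_subset_closedBall hy2)
  change φ y - ((cutoff d y : ℝ) : ℂ) * φ y = 0
  rw [hc, Complex.ofReal_one, one_mul, sub_self]

/-- A distribution supported in the unit ball is in `H^a` if its Fourier transform has a finite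
weighted `L²` norm. -/
theorem memSobolev_of_lintegral_fourierFun (T : 𝓢'(Space d, ℂ))
    (hT : Distribution.IsVanishingOn T (Metric.closedBall (0 : Space d) 1)ᶜ) (a : ℝ)
    (h : ∫⁻ ξ, ENNReal.ofReal ((1 + ‖ξ‖ ^ 2) ^ a * ‖fourierFun T ξ‖ ^ 2) < ⊤) :
    TemperedDistribution.MemSobolev a 2 T := by
  -- The exponent is `a / 2` because the `L²` norm squares the weight.
  let g : Space d → ℂ := fun ξ => (((1 + ‖ξ‖ ^ 2) ^ (a / 2) : ℝ) : ℂ)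
  have hg : g.HasTemperateGrowth := by fun_prop
  have hm : MemLp (fun ξ => g ξ * fourierFun T ξ) 2 volume := by
    refine ⟨(hg.1.continuous.mul (continuous_fourierFun T)).aestronglyMeasurable, ?_⟩
    rw [eLpNorm_lt_top_iff_lintegral_rpow_enorm_lt_top (by norm_num) (by norm_num)]
    convert h using 3 with ξ
    rw [← ofReal_norm, ENNReal.ofReal_rpow_of_nonneg (norm_nonneg _) (by simp)]
    congr 1
    simp only [ENNReal.toReal_ofNat, Real.rpow_two, norm_mul, mul_pow, g, Complex.norm_real,
      Real.norm_eq_abs, sq_abs]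
    rw [← Real.rpow_mul_natCast (by positivity)]
    congr 2
    push_cast
    ring
  rw [TemperedDistribution.memSobolev_iff_exists_smulLeftCLM_fourier]
  refine ⟨hm.toLp, ?_⟩
  ext φ
  rw [TemperedDistribution.smulLeftCLM_apply_apply, TemperedDistribution.fourier_apply,
    apply_eq_pairSmooth T hT, pairSmooth_fourier, Lp.toTemperedDistribution_apply]
  refine integral_congr_ae ?_
  filter_upwards [hm.coeFn_toLp] with ξ hξ
  rw [hξ, SchwartzMap.smulLeftCLM_apply_apply hg]
  simp only [smul_eq_mul, g]
  ring

/-! ### Weighted convolution estimates -/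

theorem rpow_le_rpow_of_comparable {a b c : ℝ} (ha : 0 < a) (hb : 0 < b) (hc : 0 < c)
    (hab : a ≤ c * b) (hba : b ≤ c * a) (t : ℝ) : a ^ t ≤ c ^ |t| * b ^ t := by
  rcases le_total 0 t with ht | ht
  · rw [abs_of_nonneg ht, ← Real.mul_rpow hc.le hb.le]
    exact Real.rpow_le_rpow ha.le hab ht
  · rw [abs_of_nonpos ht, Real.rpow_neg hc.le, ← Real.inv_rpow hc.le,
      ← Real.mul_rpow (by positivity) hb.le]
    refine Real.rpow_le_rpow_of_nonpos (by positivity) ?_ ht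
    rwa [inv_mul_le_iff₀ hc]

theorem one_add_norm_sq_le_mul (ξ ζ : Space d) :
    1 + ‖ξ‖ ^ 2 ≤ 2 * (1 + ‖ξ - ζ‖ ^ 2) * (1 + ‖ζ‖ ^ 2) := by
  have h1 : ‖ξ‖ ≤ ‖ξ - ζ‖ + ‖ζ‖ := by simpa using norm_add_le (ξ - ζ) ζ
  have h2 : ‖ξ‖ ^ 2 ≤ (‖ξ - ζ‖ + ‖ζ‖) ^ 2 := by gcongr
  nlinarith [sq_nonneg (‖ξ - ζ‖ - ‖ζ‖), sq_nonneg (‖ξ - ζ‖ * ‖ζ‖), sq_nonneg ‖ζ‖,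
    sq_nonneg ‖ξ - ζ‖]

/-- Peetre's inequality. -/
theorem one_add_norm_sq_rpow_le (ξ ζ : Space d) (t : ℝ) :
    (1 + ‖ξ‖ ^ 2) ^ t ≤ 2 ^ |t| * (1 + ‖ξ - ζ‖ ^ 2) ^ |t| * (1 + ‖ζ‖ ^ 2) ^ t := by
  rw [← Real.mul_rpow (by positivity) (by positivity)]
  refine rpow_le_rpow_of_comparable (by positivity) (by positivity) (by positivity)
    (one_add_norm_sq_le_mul ξ ζ) ?_ t
  rw [norm_sub_rev]
  exact one_add_norm_sq_le_mul ζ ξ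

/-- Convolving a function of order `-m` with a rapidly decreasing one gives a function of
order `-m`. -/
theorem exists_integral_mul_rpow_le (m K : ℝ) (H : Space d → ℝ) (hH : LocallyIntegrable H)
    (hHK : ∀ᶠ η in Bornology.cobounded (Space d), |H η| ≤ K * (1 + ‖η‖ ^ 2) ^ (-m / 2))
    (l : ℝ) (hl : d + |m| < 2 * l) :
    ∃ C : ℝ, 0 ≤ C ∧ ∀ ζ : Space d, Integrable (fun η => |H η| * (1 + ‖η - ζ‖ ^ 2) ^ (-l)) ∧
      ∫ η, |H η| * (1 + ‖η - ζ‖ ^ 2) ^ (-l) ≤ C * (1 + ‖ζ‖ ^ 2) ^ (-m / 2) := by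
  obtain ⟨R, hR⟩ : ∃ R : ℝ, ∀ η : Space d, R < ‖η‖ → |H η| ≤ K * (1 + ‖η‖ ^ 2) ^ (-m / 2) := by
    obtain ⟨R, -, hR⟩ := (Filter.HasBasis.eventually_iff
      (Metric.hasBasis_cobounded_compl_closedBall (0 : Space d))).mp hHK
    exact ⟨R, fun η hη => hR (by simpa using hη)⟩
  set t := |-m / 2| with ht
  have ht' : t = |m| / 2 := by rw [ht, abs_div, abs_neg]; norm_num
  set S := Metric.closedBall (0 : Space d) R
  have hJl : ∀ l : ℝ, Continuous fun η : Space d => (1 + ‖η‖ ^ 2) ^ l := fun l =>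
    (by fun_prop : (fun η : Space d => (1 + ‖η‖ ^ 2) ^ l).HasTemperateGrowth).1.continuous
  -- `H` is only locally integrable on `S`; there `(1 + ‖η‖ ^ 2) ^ (m / 2) ≤ |B|` inserts the
  -- missing weight, so that Peetre's inequality applies as it does outside `S`.
  obtain ⟨B, hB⟩ := (isCompact_closedBall (0 : Space d) R).exists_bound_of_continuousOn
    (hJl (m / 2)).continuousOn
  have hHS : IntegrableOn (fun η => |H η|) S :=
    (hH.integrableOn_isCompact (isCompact_closedBall _ _)).norm
  have hW : Integrable fun η : Space d => (1 + ‖η‖ ^ 2) ^ (t - l) := by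
    have := integrable_rpow_neg_one_add_norm_sq (E := Space d) (μ := volume) (r := 2 * l - |m|)
      (by rw [finrank_euclideanSpace_fin]; linarith)
    convert this using 3
    rw [ht']
    ring
  have hHSi : Integrable (S.indicator fun η => |H η|) :=
    (integrable_indicator_iff Metric.isClosed_closedBall.measurableSet).mpr hHS
  -- A majorant with the desired order in `ζ` factored out: local mass of `H` on `S`, plus a
  -- translated kernel. Peetre costs `t = |m| / 2` powers of decay, and `hl` keeps the exponent `t -
  -- l` integrable.
  set g : Space d → Space d → ℝ := fun ζ η =>
    (2 ^ t * (1 + ‖ζ‖ ^ 2) ^ (-m / 2)) *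
      (|B| * S.indicator (fun η => |H η|) η + |K| * (1 + ‖η - ζ‖ ^ 2) ^ (t - l))
  have hg : ∀ ζ, Integrable (g ζ) := fun ζ =>
    ((hHSi.const_mul _).add ((hW.comp_sub_right ζ).const_mul _)).const_mul _
  have hle : ∀ ζ η, |H η| * (1 + ‖η - ζ‖ ^ 2) ^ (-l) ≤ g ζ η := by
    intro ζ η
    have hP := one_add_norm_sq_rpow_le η ζ (-m / 2)
    rw [← ht] at hP
    have hsplit : (1 + ‖η - ζ‖ ^ 2) ^ t * (1 + ‖η - ζ‖ ^ 2) ^ (-l) =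
        (1 + ‖η - ζ‖ ^ 2) ^ (t - l) := by
      rw [← Real.rpow_add (by positivity), sub_eq_add_neg t]
    by_cases hη : η ∈ S
    · have h1 : (1 : ℝ) ≤ (1 + ‖η‖ ^ 2) ^ (-m / 2) * |B| := by
        have h2 := (le_abs_self _).trans ((hB η hη).trans (le_abs_self B))
        calc (1 : ℝ) = (1 + ‖η‖ ^ 2) ^ (-m / 2) * (1 + ‖η‖ ^ 2) ^ (m / 2) := by
              rw [← Real.rpow_add (by positivity), neg_div, neg_add_cancel, Real.rpow_zero]
          _ ≤ _ := by gcongr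
      have h3 : (1 + ‖η - ζ‖ ^ 2) ^ (t - l) ≤ 1 :=
        Real.rpow_le_one_of_one_le_of_nonpos (by simp)
          (by rw [ht']; linarith [abs_nonneg m, (Nat.cast_nonneg d : (0 : ℝ) ≤ d)])
      have h4 : (1 + ‖η - ζ‖ ^ 2) ^ (-l) ≤ 2 ^ t * (1 + ‖ζ‖ ^ 2) ^ (-m / 2) * |B| := by
        calc (1 + ‖η - ζ‖ ^ 2) ^ (-l)
            ≤ ((1 + ‖η‖ ^ 2) ^ (-m / 2) * |B|) * (1 + ‖η - ζ‖ ^ 2) ^ (-l) :=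
              le_mul_of_one_le_left (by positivity) h1
          _ ≤ ((2 ^ t * (1 + ‖η - ζ‖ ^ 2) ^ t * (1 + ‖ζ‖ ^ 2) ^ (-m / 2)) * |B|) *
              (1 + ‖η - ζ‖ ^ 2) ^ (-l) := by gcongr
          _ = (2 ^ t * (1 + ‖ζ‖ ^ 2) ^ (-m / 2) * |B|) *
              ((1 + ‖η - ζ‖ ^ 2) ^ t * (1 + ‖η - ζ‖ ^ 2) ^ (-l)) := by ring
          _ ≤ _ := by
              rw [hsplit]
              exact mul_le_of_le_one_right (by positivity) h3
      calc |H η| * (1 + ‖η - ζ‖ ^ 2) ^ (-l)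
          ≤ |H η| * (2 ^ t * (1 + ‖ζ‖ ^ 2) ^ (-m / 2) * |B|) := by gcongr
        _ = 2 ^ t * (1 + ‖ζ‖ ^ 2) ^ (-m / 2) * (|B| * |H η| + 0) := by ring
        _ ≤ g ζ η := by
            simp only [g, Set.indicator_of_mem hη]
            gcongr
            positivity
    · have h1 := hR η (by simpa [S] using hη)
      calc |H η| * (1 + ‖η - ζ‖ ^ 2) ^ (-l)
          ≤ (|K| * (2 ^ t * (1 + ‖η - ζ‖ ^ 2) ^ t * (1 + ‖ζ‖ ^ 2) ^ (-m / 2))) *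
              (1 + ‖η - ζ‖ ^ 2) ^ (-l) := by
            refine mul_le_mul_of_nonneg_right (h1.trans ?_) (by positivity)
            refine mul_le_mul (le_abs_self K) hP (by positivity) (abs_nonneg K)
        _ = 2 ^ t * (1 + ‖ζ‖ ^ 2) ^ (-m / 2) *
              (|K| * ((1 + ‖η - ζ‖ ^ 2) ^ t * (1 + ‖η - ζ‖ ^ 2) ^ (-l))) := by ring
        _ = g ζ η := by
            simp only [g, Set.indicator_of_notMem hη, hsplit, mul_zero, zero_add]
  refine ⟨2 ^ t * (|B| * (∫ η, S.indicator (fun η => |H η|) η) +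
    |K| * ∫ η : Space d, (1 + ‖η‖ ^ 2) ^ (t - l)), ?_, fun ζ => ?_⟩
  · have h1 : 0 ≤ ∫ η, S.indicator (fun η => |H η|) η :=
      integral_nonneg fun η => Set.indicator_nonneg (fun _ _ => abs_nonneg _) _
    have h2 : 0 ≤ ∫ η : Space d, (1 + ‖η‖ ^ 2) ^ (t - l) :=
      integral_nonneg fun η => by positivity
    positivity
  · have hint : Integrable (fun η => |H η| * (1 + ‖η - ζ‖ ^ 2) ^ (-l)) := by
      refine (hg ζ).mono' (hH.aestronglyMeasurable.norm.mul
        ((hJl (-l)).comp (continuous_id.sub continuous_const)).aestronglyMeasurable)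
        (ae_of_all _ fun η => ?_)
      rw [Real.norm_eq_abs, abs_of_nonneg (by positivity)]
      exact hle ζ η
    refine ⟨hint, (integral_mono hint (hg ζ) (hle ζ)).trans (le_of_eq ?_)⟩
    simp only [g]
    rw [integral_const_mul, integral_add (hHSi.const_mul _) ((hW.comp_sub_right ζ).const_mul _),
      integral_const_mul, integral_const_mul,
      integral_sub_right_eq_self (fun η : Space d => (1 + ‖η‖ ^ 2) ^ (t - l)) ζ]
    ring

/-! ### Localized trigonometric test functions -/

/-- The test function `y ↦ χ(y) cos(2π ξ·y + θ)`. -/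
def testWave (θ : ℝ) (ξ : Space d) : RealTest d where
  toFun y := cutoff d y * Real.cos (2 * Real.pi * ⟪ξ, y⟫ + θ)
  contDiff' := by
    refine (cutoff d).contDiff.mul (Real.contDiff_cos.comp ?_)
    exact (contDiff_const.mul (contDiff_const.inner ℝ contDiff_id)).add contDiff_const
  hasCompactSupport' := (cutoff d).hasCompactSupport.mul_right
  tsupport_subset' := fun _ _ => trivial

theorem testWave_apply (θ : ℝ) (ξ y : Space d) :
    testWave θ ξ y = cutoff d y * Real.cos (2 * Real.pi * ⟪ξ, y⟫ + θ) := rfl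

/-- Euler's formula, with the phase `π/2` turning the cosine into minus the sine; the covariance is
given only for real test functions. -/
theorem fourierFun_eq_testWave (T : 𝓢'(Space d, ℂ)) (ξ : Space d) :
    fourierFun T ξ = T (testWave 0 ξ).toSchwartz +
      Complex.I * T (testWave (Real.pi / 2) ξ).toSchwartz := by
  unfold fourierFun pairSmooth
  rw [← smul_eq_mul Complex.I, ← map_smul, ← map_add]
  congr 1
  ext y
  change ((cutoff d y : ℝ) : ℂ) * planeWave (-2 * Real.pi) ξ y =
    ((testWave 0 ξ y : ℝ) : ℂ) + Complex.I * ((testWave (Real.pi / 2) ξ y : ℝ) : ℂ)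
  rw [testWave_apply, testWave_apply, Real.cos_add_pi_div_two, add_zero, planeWave, mul_comm Complex.I,
    Complex.exp_mul_I, ← Complex.ofReal_cos, ← Complex.ofReal_sin, mul_assoc, neg_mul, Real.cos_neg,
    Real.sin_neg, mul_assoc 2]
  push_cast
  ring

theorem abs_testWave_le (θ : ℝ) (ξ y : Space d) :
    |testWave θ ξ y| ≤ (Metric.closedBall (0 : Space d) 3).indicator 1 y := by
  rw [testWave_apply, abs_mul]
  by_cases hy : y ∈ Metric.closedBall (0 : Space d) 3
  · rw [Set.indicator_of_mem hy, Pi.one_apply, abs_of_nonneg (cutoff d).nonneg]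
    exact mul_le_one₀ (cutoff d).le_one (abs_nonneg _) (Real.abs_cos_le_one _)
  · rw [Set.indicator_of_notMem hy, (cutoff d).zero_of_le_dist, abs_zero, zero_mul]
    rw [Metric.mem_closedBall] at hy
    exact (not_le.mp hy).le

/-- Each exponential in the cosine translates the transform of the cutoff, by `±2πξ` since
`fourierHat` uses `e^{-i y·η}` without `2π`. -/
theorem fourierHat_testWave (θ : ℝ) (ξ η : Space d) :
    fourierHat (testWave θ ξ) η =
      2⁻¹ * (Complex.exp (Complex.I * θ) * fourierHat (cutoff d) (η - (2 * Real.pi) • ξ) +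
        Complex.exp (-Complex.I * θ) * fourierHat (cutoff d) (η + (2 * Real.pi) • ξ)) := by
  have hint : ∀ ζ : Space d, Integrable fun y : Space d =>
      ((cutoff d y : ℝ) : ℂ) * Complex.exp (-Complex.I * (⟪y, ζ⟫ : ℝ)) := fun ζ => by
    refine Continuous.integrable_of_hasCompactSupport ?_ ?_
    · have := (cutoff d).continuous
      fun_prop
    · exact ((cutoff d).hasCompactSupport.comp_left (g := fun t : ℝ => (t : ℂ))
        Complex.ofReal_zero).mul_right
  rw [fourierHat, fourierHat, fourierHat, ← integral_const_mul, ← integral_const_mul,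
    ← integral_add ((hint _).const_mul _) ((hint _).const_mul _), ← integral_const_mul]
  refine integral_congr_ae (ae_of_all _ fun y => ?_)
  simp only [testWave_apply]
  rw [inner_sub_right, inner_add_right, inner_smul_right, real_inner_comm y ξ]
  push_cast
  rw [Complex.cos]
  have e1 : Complex.exp (-Complex.I * (⟪y, η⟫ - 2 * Real.pi * ⟪y, ξ⟫)) =
      Complex.exp (-Complex.I * ⟪y, η⟫) * Complex.exp (Complex.I * (2 * Real.pi * ⟪y, ξ⟫)) := by
    rw [← Complex.exp_add]
    ring_nf
  have e2 : Complex.exp (-Complex.I * (⟪y, η⟫ + 2 * Real.pi * ⟪y, ξ⟫)) =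
      Complex.exp (-Complex.I * ⟪y, η⟫) * Complex.exp (-Complex.I * (2 * Real.pi * ⟪y, ξ⟫)) := by
    rw [← Complex.exp_add]
    ring_nf
  have e3 : Complex.exp ((2 * Real.pi * ⟪y, ξ⟫ + θ) * Complex.I) =
      Complex.exp (Complex.I * (2 * Real.pi * ⟪y, ξ⟫)) * Complex.exp (Complex.I * θ) := by
    rw [← Complex.exp_add]
    ring_nf
  have e4 : Complex.exp (-(2 * Real.pi * ⟪y, ξ⟫ + θ) * Complex.I) =
      Complex.exp (-Complex.I * (2 * Real.pi * ⟪y, ξ⟫)) * Complex.exp (-Complex.I * θ) := by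
    rw [← Complex.exp_add]
    ring_nf
  rw [e1, e2, e3, e4]
  ring

theorem exists_norm_fourierHat_cutoff_le (d l : ℕ) :
    ∃ C : ℝ, 0 ≤ C ∧ ∀ η : Space d,
      ‖fourierHat (cutoff d) η‖ ≤ C * (1 + ‖η‖ ^ 2) ^ (-(l : ℝ)) := by
  let χ : 𝓢(Space d, ℂ) := HasCompactSupport.toSchwartzMap (f := fun y => ((cutoff d y : ℝ) : ℂ))
    ((cutoff d).hasCompactSupport.comp_left (g := fun t : ℝ => (t : ℂ)) Complex.ofReal_zero)
    (Complex.ofRealCLM.contDiff.comp (cutoff d).contDiff)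
  have hF : ∀ η : Space d, fourierHat (cutoff d) η =
      (𝓕 χ : 𝓢(Space d, ℂ)) ((2 * Real.pi)⁻¹ • η) := fun η => by
    rw [SchwartzMap.fourier_coe, Real.fourier_eq, fourierHat]
    refine integral_congr_ae (ae_of_all _ fun y => ?_)
    simp only [Circle.smul_def, Real.fourierChar_apply, smul_eq_mul, inner_smul_right]
    have hpi : (2 * Real.pi) ≠ 0 := by positivity
    rw [mul_comm, show 2 * Real.pi * -((2 * Real.pi)⁻¹ * ⟪y, η⟫) = -⟪y, η⟫ by field_simp]
    congr 2
    push_cast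
    ring
  obtain ⟨C, hC⟩ : ∃ C : ℝ, ∀ x : Space d,
      (1 + ‖x‖) ^ (2 * l) * ‖(𝓕 χ : 𝓢(Space d, ℂ)) x‖ ≤ C := by
    refine ⟨2 ^ (2 * l) * ((Finset.Iic (2 * l, 0)).sup fun m => SchwartzMap.seminorm ℂ m.1 m.2)
      (𝓕 χ : 𝓢(Space d, ℂ)), fun x => ?_⟩
    have := SchwartzMap.one_add_le_sup_seminorm_apply (𝕜 := ℂ) (m := (2 * l, 0)) le_rfl le_rfl
      (𝓕 χ : 𝓢(Space d, ℂ)) x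
    rwa [norm_iteratedFDeriv_zero] at this
  have hC0 : 0 ≤ C := le_trans (by positivity) (hC 0)
  refine ⟨C * (2 * Real.pi) ^ (2 * l), by positivity, fun η => ?_⟩
  rw [Real.rpow_neg (by positivity), Real.rpow_natCast, ← div_eq_mul_inv,
    le_div_iff₀ (by positivity), hF]
  have hpi : (1 : ℝ) ≤ 2 * Real.pi := by linarith [Real.pi_gt_three]
  have h1 : 1 + ‖η‖ ^ 2 ≤ ((2 * Real.pi) * (1 + ‖(2 * Real.pi)⁻¹ • η‖)) ^ 2 := by
    rw [norm_smul, norm_inv, Real.norm_eq_abs, abs_of_pos (by positivity), mul_add,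
      mul_inv_cancel_left₀ (by positivity)]
    nlinarith [norm_nonneg η]
  calc _ ≤ ‖(𝓕 χ : 𝓢(Space d, ℂ)) ((2 * Real.pi)⁻¹ • η)‖ *
        (((2 * Real.pi) * (1 + ‖(2 * Real.pi)⁻¹ • η‖)) ^ 2) ^ l := by gcongr
    _ = ((1 + ‖(2 * Real.pi)⁻¹ • η‖) ^ (2 * l) *
        ‖(𝓕 χ : 𝓢(Space d, ℂ)) ((2 * Real.pi)⁻¹ • η)‖) * (2 * Real.pi) ^ (2 * l) := by
      rw [← pow_mul, mul_pow]
      ring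
    _ ≤ _ := by gcongr; exact hC _

theorem exists_norm_fourierHat_testWave_le (d l : ℕ) :
    ∃ C : ℝ, 0 ≤ C ∧ ∀ (θ : ℝ) (ξ η : Space d), ‖fourierHat (testWave θ ξ) η‖ ≤
      C * ((1 + ‖η - (2 * Real.pi) • ξ‖ ^ 2) ^ (-(l : ℝ)) +
        (1 + ‖η - (-(2 * Real.pi) • ξ)‖ ^ 2) ^ (-(l : ℝ))) := by
  obtain ⟨C, hC0, hC⟩ := exists_norm_fourierHat_cutoff_le d l
  refine ⟨C, hC0, fun θ ξ η => ?_⟩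
  have h1 := hC (η - (2 * Real.pi) • ξ)
  have h2 := hC (η + (2 * Real.pi) • ξ)
  have e1 : ‖Complex.exp (Complex.I * θ)‖ = 1 := by
    rw [mul_comm]; exact Complex.norm_exp_ofReal_mul_I θ
  have e2 : ‖Complex.exp (-Complex.I * θ)‖ = 1 := by
    rw [show -Complex.I * (θ : ℂ) = ((-θ : ℝ) : ℂ) * Complex.I by push_cast; ring]
    exact Complex.norm_exp_ofReal_mul_I _
  have h3 := norm_add_le
    (Complex.exp (Complex.I * θ) * fourierHat (cutoff d) (η - (2 * Real.pi) • ξ))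
    (Complex.exp (-Complex.I * θ) * fourierHat (cutoff d) (η + (2 * Real.pi) • ξ))
  rw [norm_mul, norm_mul, e1, e2, one_mul, one_mul] at h3
  rw [fourierHat_testWave, norm_mul, neg_smul, sub_neg_eq_add, norm_inv, Complex.norm_ofNat]
  linarith [norm_nonneg (Complex.exp (Complex.I * θ) *
    fourierHat (cutoff d) (η - (2 * Real.pi) • ξ) + Complex.exp (-Complex.I * θ) *
    fourierHat (cutoff d) (η + (2 * Real.pi) • ξ))]

/-! ### Second moments -/

/-- A symbol with principal part `σ(x)|ξ|^{-m}` is dominated by a product. -/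
theorem HasIsotropicPrincipalPart.exists_norm_le {m : ℝ} {σ : Space d → ℝ}
    {c : Space d → Space d → ℂ} (hc : HasIsotropicPrincipalPart m σ c) (hσ : ∀ x, 0 ≤ σ x) :
    ∃ (A K : ℝ) (G : Space d → ℝ), LocallyIntegrable G ∧
      (∀ᶠ η in Bornology.cobounded (Space d), |G η| ≤ K * (1 + ‖η‖ ^ 2) ^ (-m / 2)) ∧
      ∀ x η, ‖c x η‖ ≤ (σ x + |A|) * |G η| := by
  obtain ⟨h, r, ⟨hh, hh'⟩, ⟨-, hr⟩, -, hc⟩ := hc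
  obtain ⟨A, hA⟩ := hr 0 0
  have hJ : Continuous fun η : Space d => (1 + ‖η‖ ^ 2) ^ (-m / 2) :=
    (by fun_prop : (fun η : Space d => (1 + ‖η‖ ^ 2) ^ (-m / 2)).HasTemperateGrowth).1.continuous
  -- The second summand of `G` absorbs the remainder, of lower order `-m - 1`. For `‖η‖ > 1`, `‖η‖ ^
  -- 2` and `1 + ‖η‖ ^ 2` agree up to a factor `2`, whence `2 ^ |-m / 2|`.
  refine ⟨A, 2 ^ |-m / 2| + 1, fun η => |h η| + (1 + ‖η‖ ^ 2) ^ (-m / 2),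
    LocallyIntegrable.add (fun x => (hh x).norm) hJ.locallyIntegrable, ?_, fun x η => ?_⟩
  · have h1 : ∀ᶠ η in Bornology.cobounded (Space d), η ∈ (Metric.closedBall (0 : Space d) 1)ᶜ :=
      (Metric.hasBasis_cobounded_compl_closedBall (0 : Space d)).mem_of_mem trivial
    filter_upwards [hh', h1] with η hη hη1
    have hη1 : 1 < ‖η‖ := by simpa using hη1
    rw [abs_of_nonneg (by positivity), add_mul, one_mul, hη, abs_of_nonneg (by positivity)]
    gcongr
    have : ‖η‖ ^ (-m) = (‖η‖ ^ 2) ^ (-m / 2) := by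
      rw [← Real.rpow_natCast, ← Real.rpow_mul (norm_nonneg _)]
      congr 1
      push_cast
      ring
    rw [this]
    exact rpow_le_rpow_of_comparable (by positivity) (by positivity) two_pos (by nlinarith)
      (by nlinarith) _
  · have h1 := hA x η
    rw [norm_iteratedFDeriv_zero, norm_iteratedFDeriv_zero] at h1
    have h2 : (1 + ‖η‖ ^ 2) ^ ((-m - 1 - (0 : ℕ)) / 2) ≤ (1 + ‖η‖ ^ 2) ^ (-m / 2) :=
      Real.rpow_le_rpow_of_exponent_le (by simp) (by push_cast; linarith)
    have h3 : ‖r x η‖ ≤ |A| * (1 + ‖η‖ ^ 2) ^ (-m / 2) :=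
      h1.trans (mul_le_mul (le_abs_self A) h2 (by positivity) (abs_nonneg A))
    rw [hc, abs_of_nonneg (a := |h η| + _) (by positivity)]
    refine (norm_add_le _ _).trans ?_
    rw [Complex.norm_real, Real.norm_eq_abs, abs_mul, abs_of_nonneg (hσ x)]
    have h4 : 0 ≤ σ x * (1 + ‖η‖ ^ 2) ^ (-m / 2) := mul_nonneg (hσ x) (by positivity)
    have h5 : 0 ≤ |A| * |h η| := by positivity
    linarith

/-- The variance of the pairing of the field with a localized wave of frequency `ξ` is of
order `-m`. -/
theorem exists_norm_covariance_testWave_le {m : ℝ} {σ : Space d → ℝ}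
    {c : Space d → Space d → ℂ} (hc : HasIsotropicPrincipalPart m σ c) (hσ : ∀ x, 0 ≤ σ x)
    (hσi : IntegrableOn σ (Metric.closedBall 0 3)) :
    ∃ C : ℝ, 0 ≤ C ∧ ∀ (θ : ℝ) (ξ : Space d),
      ‖∫ x, opOfSymbol c (testWave θ ξ) x * (testWave θ ξ x : ℂ)‖ ≤
        C * (1 + ‖ξ‖ ^ 2) ^ (-m / 2) := by
  obtain ⟨A, K, G, hG, hGK, hcG⟩ := hc.exists_norm_le hσ
  obtain ⟨l, hl⟩ := exists_nat_gt ((d + |m|) / 2)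
  obtain ⟨D, hD0, hD⟩ := exists_integral_mul_rpow_le m K G hG hGK l (by linarith)
  obtain ⟨F, hF0, hF⟩ := exists_norm_fourierHat_testWave_le d l
  set P : ℝ := (2 * Real.pi) ^ d
  have hP : 0 < P := by positivity
  set S := Metric.closedBall (0 : Space d) 3
  -- Cost of replacing the frequency `±2πξ` by `ξ` in the weight.
  set L : ℝ := ((2 * Real.pi) ^ 2) ^ |-m / 2|
  have hL : ∀ (ξ : Space d) (a : ℝ), |a| = 2 * Real.pi →
      (1 + ‖a • ξ‖ ^ 2) ^ (-m / 2) ≤ L * (1 + ‖ξ‖ ^ 2) ^ (-m / 2) := fun ξ a ha => by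
    have hpi : (1 : ℝ) ≤ (2 * Real.pi) ^ 2 := by nlinarith [Real.pi_gt_three]
    have hx := sq_nonneg ‖ξ‖
    refine rpow_le_rpow_of_comparable (by positivity) (by positivity) (by positivity) ?_ ?_ _ <;>
    rw [norm_smul, Real.norm_eq_abs, ha, mul_pow]
    · nlinarith
    · nlinarith [mul_nonneg (mul_nonneg (by positivity : 0 ≤ (2 * Real.pi) ^ 2) hx)
        (by linarith : 0 ≤ (2 * Real.pi) ^ 2 - 1), mul_nonneg hx (by linarith : 0 ≤ (2 * Real.pi) ^ 2 - 1)]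
  have hop : ∀ θ ξ x, ‖opOfSymbol c (testWave θ ξ) x‖ ≤
      (σ x + |A|) * (P⁻¹ * (F * (2 * D * L))) * (1 + ‖ξ‖ ^ 2) ^ (-m / 2) := by
    intro θ ξ x
    obtain ⟨i1, b1⟩ := hD ((2 * Real.pi) • ξ)
    obtain ⟨i2, b2⟩ := hD (-(2 * Real.pi) • ξ)
    have b1' := b1.trans (mul_le_mul_of_nonneg_left
      (hL ξ (2 * Real.pi) (abs_of_pos (by positivity))) hD0)
    have b2' := b2.trans (mul_le_mul_of_nonneg_left
      (hL ξ (-(2 * Real.pi)) (by rw [abs_neg, abs_of_pos (by positivity)])) hD0)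
    have hsA : 0 ≤ σ x + |A| := add_nonneg (hσ x) (abs_nonneg A)
    have hI : ‖∫ ξ', Complex.exp (Complex.I * (⟪x, ξ'⟫ : ℝ)) * c x ξ' *
        fourierHat (testWave θ ξ) ξ'‖ ≤
        ∫ η, (σ x + |A|) * F * (|G η| * (1 + ‖η - (2 * Real.pi) • ξ‖ ^ 2) ^ (-(l : ℝ)) +
          |G η| * (1 + ‖η - (-(2 * Real.pi) • ξ)‖ ^ 2) ^ (-(l : ℝ))) := by
      refine norm_integral_le_of_norm_le ((i1.add i2).const_mul _) (ae_of_all _ fun η => ?_)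
      rw [norm_mul, norm_mul, mul_comm Complex.I, Complex.norm_exp_ofReal_mul_I, one_mul]
      refine (mul_le_mul (hcG x η) (hF θ ξ η) (norm_nonneg _) (by positivity)).trans
        (le_of_eq ?_)
      ring
    rw [integral_const_mul, integral_add i1 i2] at hI
    rw [opOfSymbol, norm_mul, norm_inv, Complex.norm_real, Real.norm_eq_abs, abs_of_pos hP]
    calc _ ≤ P⁻¹ * ((σ x + |A|) * F * (D * (L * (1 + ‖ξ‖ ^ 2) ^ (-m / 2)) +
          D * (L * (1 + ‖ξ‖ ^ 2) ^ (-m / 2)))) := by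
          refine mul_le_mul_of_nonneg_left (hI.trans ?_) (by positivity)
          gcongr
      _ = _ := by ring
  have hsi : Integrable (S.indicator fun x => σ x + |A|) :=
    (integrable_indicator_iff Metric.isClosed_closedBall.measurableSet).mpr
      (hσi.add (integrableOn_const (isCompact_closedBall _ _).measure_lt_top.ne))
  refine ⟨(∫ x, S.indicator (fun x => σ x + |A|) x) * (P⁻¹ * (F * (2 * D * L))), ?_,
    fun θ ξ => ?_⟩
  · refine mul_nonneg (integral_nonneg fun x => Set.indicator_nonneg (fun y _ => ?_) x)
      (by positivity)
    exact add_nonneg (hσ y) (abs_nonneg A)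
  · rw [mul_assoc, ← integral_mul_const]
    refine norm_integral_le_of_norm_le (hsi.mul_const _) (ae_of_all _ fun x => ?_)
    rw [norm_mul, Complex.norm_real, Real.norm_eq_abs]
    have h0 : 0 ≤ (σ x + |A|) * (P⁻¹ * (F * (2 * D * L))) * (1 + ‖ξ‖ ^ 2) ^ (-m / 2) :=
      (norm_nonneg _).trans (hop θ ξ x)
    refine (mul_le_mul (hop θ ξ x) (abs_testWave_le θ ξ x) (abs_nonneg _) h0).trans
      (le_of_eq ?_)
    by_cases hx : x ∈ S
    · rw [Set.indicator_of_mem hx, Set.indicator_of_mem hx, Pi.one_apply]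
      ring
    · rw [Set.indicator_of_notMem hx, Set.indicator_of_notMem hx]
      ring

/-- The strength of a field with `√σ ∈ W₀^{s,4}` is integrable on bounded sets. -/
theorem integrableOn_of_memW0_sqrt {s : ℕ} {σ : Space d → ℝ} (hσ : ∀ x, 0 ≤ σ x)
    (h : MemW0 s 4 fun x => Real.sqrt (σ x)) (R : ℝ) :
    IntegrableOn σ (Metric.closedBall 0 R) := by
  obtain ⟨hm, φ, hφ, hlim, -⟩ := h
  -- A single approximant at finite `L⁴` distance puts `√σ` in `L⁴`, hence in `L²` on a ball, so `σ`
  -- is integrable there.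
  obtain ⟨j, hj⟩ := (hlim.eventually (gt_mem_nhds ENNReal.zero_lt_top)).exists
  have h1 : MemLp (φ j) 4 volume :=
    (hφ j).1.continuous.memLp_of_hasCompactSupport (hφ j).2.1
  have h2 : MemLp (fun x => φ j x - Real.sqrt (σ x)) 4 volume :=
    ⟨h1.aestronglyMeasurable.sub hm, hj⟩
  have h3 : MemLp (fun x => Real.sqrt (σ x)) 4 volume := by
    simpa [Pi.sub_def] using h1.sub h2
  have : IsFiniteMeasure (volume.restrict (Metric.closedBall (0 : Space d) R)) :=
    ⟨by simpa using (isCompact_closedBall (0 : Space d) R).measure_lt_top⟩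
  have h4 := ((h3.restrict (Metric.closedBall 0 R)).mono_exponent
    (by norm_num : (2 : ℝ≥0∞) ≤ 4)).integrable_sq
  simpa only [IntegrableOn, Real.sq_sqrt (hσ _)] using h4

/-! ### Regularity of the random field -/

variable {Ω : Type*} [MeasurableSpace Ω] {P : Measure Ω}

/-- A random continuous function with a.e. measurable values has a jointly measurable
modification. -/
theorem exists_measurable_modification {u : Space d → Ω → ℂ} (hu : ∀ w, Continuous fun ξ => u ξ w)
    (hm : ∀ ξ, AEMeasurable (u ξ) P) :
    ∃ v : Space d → Ω → ℂ, Measurable (Function.uncurry v) ∧ ∀ᵐ w ∂P, ∀ ξ, v ξ w = u ξ w := by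
  let q := TopologicalSpace.denseSeq (Space d)
  -- Continuity in `ξ` allows one null set, chosen on a countable dense set of frequencies, to serve
  -- for all `ξ`; the modification is `0` on a measurable null superset.
  have h0 : ∀ᵐ w ∂P, ∀ n, u (q n) w = (hm (q n)).mk _ w := ae_all_iff.mpr fun n =>
    (hm (q n)).ae_eq_mk
  obtain ⟨S, hSsub, hSm, hS0⟩ := exists_measurable_superset_of_null (ae_iff.mp h0)
  let v : Space d → Ω → ℂ := fun ξ => Sᶜ.indicator (u ξ)
  have hvc : ∀ w, Continuous fun ξ => v ξ w := fun w => by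
    by_cases hw : w ∈ Sᶜ
    · simpa only [v, Set.indicator_of_mem hw] using hu w
    · simpa only [v, Set.indicator_of_notMem hw] using continuous_const
  have hvq : ∀ n, Measurable (v (q n)) := fun n => by
    have : v (q n) = Sᶜ.indicator ((hm (q n)).mk _) := by
      refine Set.indicator_congr fun w hw => ?_
      by_contra hne
      exact hw (hSsub fun h => hne (h n))
    rw [this]
    exact (hm (q n)).measurable_mk.indicator hSm.compl
  have hvm : ∀ ξ, Measurable (v ξ) := fun ξ => by
    obtain ⟨x, hx, hxξ⟩ := mem_closure_iff_seq_limit.mp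
      (TopologicalSpace.denseRange_denseSeq (Space d) ξ)
    choose n hn using hx
    refine measurable_of_tendsto_metrizable (f := fun j => v (x j)) (fun j => ?_) ?_
    · rw [← hn j]
      exact hvq (n j)
    · exact tendsto_pi_nhds.mpr fun w => ((hvc w).tendsto ξ).comp hxξ
  refine ⟨v, measurable_uncurry_of_continuous_of_measurable hvc hvm, ?_⟩
  filter_upwards [measure_eq_zero_iff_ae_notMem.mp hS0] with w hw ξ
  exact Set.indicator_of_mem (s := Sᶜ) hw _

namespace IsGMIGField

variable {m : ℝ} {σ : Space d → ℝ} {f : Ω → 𝓢'(Space d, ℂ)}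

theorem ae_fourierFun_eq (hf : IsGMIGField P m σ f) :
    ∀ᵐ w ∂P, ∀ ξ, fourierFun (f w) ξ = (pairReal f (testWave 0 ξ) w : ℂ) +
      Complex.I * (pairReal f (testWave (Real.pi / 2) ξ) w : ℂ) := by
  filter_upwards [hf.real] with w hw ξ
  have h : ∀ φ : RealTest d, f w φ.toSchwartz = (pairReal f φ w : ℂ) := fun φ =>
    Complex.ext (by simp [pairReal]) (by simpa using hw φ)
  rw [fourierFun_eq_testWave, h, h]

theorem aemeasurable_pairReal (hf : IsGMIGField P m σ f) (φ : RealTest d) :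
    AEMeasurable (pairReal f φ) P := hf.gaussian.aemeasurable φ

theorem integrable_sq_pairReal (hf : IsGMIGField P m σ f) (φ : RealTest d) :
    Integrable (fun w => pairReal f φ w ^ 2) P :=
  (hf.gaussian.hasGaussianLaw_eval φ).memLp_two.integrable_sq

theorem aemeasurable_fourierFun (hf : IsGMIGField P m σ f) (ξ : Space d) :
    AEMeasurable (fun w => fourierFun (f w) ξ) P := by
  have h := hf.aemeasurable_pairReal
  refine AEMeasurable.congr (f := fun w => (pairReal f (testWave 0 ξ) w : ℂ) +
    Complex.I * (pairReal f (testWave (Real.pi / 2) ξ) w : ℂ)) ?_ ?_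
  · exact (Complex.measurable_ofReal.comp_aemeasurable (h _)).add
      ((Complex.measurable_ofReal.comp_aemeasurable (h _)).const_mul _)
  · filter_upwards [hf.ae_fourierFun_eq] with w hw
    exact (hw ξ).symm

/-- The mean square of the Fourier transform of the field at the frequency `ξ` is of order `-m`. -/
theorem exists_lintegral_fourierFun_le (hf : IsGMIGField P m σ f) (hσ : ∀ x, 0 ≤ σ x)
    (hσi : IntegrableOn σ (Metric.closedBall 0 3)) :
    ∃ C : ℝ, 0 ≤ C ∧ ∀ ξ, ∫⁻ w, ENNReal.ofReal (‖fourierFun (f w) ξ‖ ^ 2) ∂P ≤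
      ENNReal.ofReal (C * (1 + ‖ξ‖ ^ 2) ^ (-m / 2)) := by
  obtain ⟨c, hc, hcov⟩ := hf.covariance
  obtain ⟨C, hC0, hC⟩ := exists_norm_covariance_testWave_le hc hσ hσi
  -- One `C` each for the real and the imaginary part.
  refine ⟨2 * C, by positivity, fun ξ => ?_⟩
  have hmom : ∀ θ, ∫ w, pairReal f (testWave θ ξ) w ^ 2 ∂P ≤ C * (1 + ‖ξ‖ ^ 2) ^ (-m / 2) := by
    intro θ
    have h1 := hC θ ξ
    rw [← hcov, Complex.norm_real] at h1
    simpa only [pow_two] using (Real.le_norm_self _).trans h1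
  have hi := hf.integrable_sq_pairReal
  calc ∫⁻ w, ENNReal.ofReal (‖fourierFun (f w) ξ‖ ^ 2) ∂P
      = ∫⁻ w, ENNReal.ofReal (pairReal f (testWave 0 ξ) w ^ 2 +
          pairReal f (testWave (Real.pi / 2) ξ) w ^ 2) ∂P := by
        refine lintegral_congr_ae ?_
        filter_upwards [hf.ae_fourierFun_eq] with w hw
        rw [hw ξ, ← Complex.normSq_eq_norm_sq, mul_comm Complex.I, Complex.normSq_add_mul_I]
    _ = ENNReal.ofReal (∫ w, (pairReal f (testWave 0 ξ) w ^ 2 +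
          pairReal f (testWave (Real.pi / 2) ξ) w ^ 2) ∂P) :=
        (ofReal_integral_eq_lintegral_ofReal ((hi _).add (hi _))
          (ae_of_all _ fun w => add_nonneg (sq_nonneg _) (sq_nonneg _))).symm
    _ ≤ _ := by
        refine ENNReal.ofReal_le_ofReal ?_
        rw [integral_add (hi _) (hi _)]
        linarith [hmom 0, hmom (Real.pi / 2)]

/-- A nonnegative quantity with finite expectation is almost surely finite. Tonelli requires joint
measurability, hence the modification `v`. -/
theorem ae_lintegral_fourierFun_lt_top [SFinite P] (hf : IsGMIGField P m σ f)
    (hσ : ∀ x, 0 ≤ σ x) (hσi : IntegrableOn σ (Metric.closedBall 0 3)) {ε : ℝ} (hε : 0 < ε) :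
    ∀ᵐ w ∂P, ∫⁻ ξ, ENNReal.ofReal ((1 + ‖ξ‖ ^ 2) ^ (-(((d : ℝ) - m) / 2) - ε) *
      ‖fourierFun (f w) ξ‖ ^ 2) < ⊤ := by
  set a := -(((d : ℝ) - m) / 2) - ε
  obtain ⟨C, hC0, hC⟩ := hf.exists_lintegral_fourierFun_le hσ hσi
  obtain ⟨v, hvm, hv⟩ := exists_measurable_modification
    (fun w => continuous_fourierFun (f w)) hf.aemeasurable_fourierFun
  have hmeas : Measurable (Function.uncurry fun (w : Ω) (ξ : Space d) =>
      ENNReal.ofReal ((1 + ‖ξ‖ ^ 2) ^ a * ‖v ξ w‖ ^ 2)) := by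
    have h2 : Measurable fun z : Ω × Space d => v z.2 z.1 := hvm.comp measurable_swap
    unfold Function.uncurry
    fun_prop
  have hfin : ∫⁻ w, (∫⁻ ξ, ENNReal.ofReal ((1 + ‖ξ‖ ^ 2) ^ a * ‖v ξ w‖ ^ 2)) ∂P < ⊤ := by
    rw [lintegral_lintegral_swap hmeas.aemeasurable]
    -- The exponent is `a - m / 2 = -(d + 2ε) / 2`, just below the threshold `-d / 2`.
    have hint : Integrable fun ξ : Space d => C * (1 + ‖ξ‖ ^ 2) ^ (-(d + 2 * ε) / 2) :=
      (integrable_rpow_neg_one_add_norm_sq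
        (by rw [finrank_euclideanSpace_fin]; linarith)).const_mul C
    refine lt_of_le_of_lt (lintegral_mono fun ξ => ?_) hint.lintegral_lt_top
    simp_rw [ENNReal.ofReal_mul (by positivity : 0 ≤ (1 + ‖ξ‖ ^ 2) ^ a)]
    rw [lintegral_const_mul' _ _ ENNReal.ofReal_ne_top]
    have h1 : ∫⁻ w, ENNReal.ofReal (‖v ξ w‖ ^ 2) ∂P =
        ∫⁻ w, ENNReal.ofReal (‖fourierFun (f w) ξ‖ ^ 2) ∂P := by
      refine lintegral_congr_ae ?_
      filter_upwards [hv] with w hw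
      rw [hw ξ]
    rw [h1]
    refine (mul_le_mul_right (hC ξ) _).trans (le_of_eq ?_)
    rw [← ENNReal.ofReal_mul (by positivity), mul_left_comm, ← Real.rpow_add (by positivity)]
    congr 3
    simp only [a]
    ring
  have hae := ae_lt_top hmeas.lintegral_prod_right' hfin.ne
  filter_upwards [hae, hv] with w hw hvw
  simpa only [Function.uncurry_apply_pair, hvw] using hw

end IsGMIGField

end RandomSource

end

theorem mainTheorem5 {Ω : Type*} [MeasurableSpace Ω] (P : Measure Ω) [IsProbabilityMeasure P]
    (d : ℕ) (hd : d = 2 ∨ d = 3) (n : ℕ) (hn : 1 ≤ n) (m : ℝ) (s : ℕ)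
    (σ : RandomSource.Space d → ℝ) (f : Ω → 𝓢'(RandomSource.Space d, ℂ))
    (hf : RandomSource.IsAdmissibleSource P n m s σ f) (k : ℝ) (hk : 0 < k) :
    ∀ᵐ w ∂P,
      (∀ ε : ℝ, 0 < ε →
        TemperedDistribution.MemSobolev (-(((d : ℝ) - m) / 2) - ε) 2 (f w)) ∧
      ∃ C : ℝ, ∀ xhat ∈ Metric.sphere (0 : RandomSource.Space d) 1,
        ‖RandomSource.farField n k (f w) xhat‖ ≤ C := by
  have hσi := RandomSource.integrableOn_of_memW0_sqrt hf.strength_nonneg hf.sqrt_strength 3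
  -- Only `ε = 1 / (j + 1)` is treated almost surely; monotonicity of the Sobolev scale covers every
  -- other `ε`.
  have hfin := ae_all_iff.mpr fun j : ℕ => hf.field.ae_lintegral_fourierFun_lt_top
    hf.strength_nonneg hσi (Nat.one_div_pos_of_nat (α := ℝ) (n := j))
  filter_upwards [hfin, hf.field.supp] with w hw hsupp
  refine ⟨fun ε hε => ?_, RandomSource.exists_norm_farField_le n k (f w)⟩
  obtain ⟨j, hj⟩ := exists_nat_one_div_lt hε
  exact (RandomSource.memSobolev_of_lintegral_fourierFun (f w) hsupp _ (hw j)).mono (by linarith)
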